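/- Let $\Gamma$ be a finite, connected, simple graph that is neither a path (isomorphic to the path graph $P_n$ on $n$ vertices for some $n\ge 1$; the one-vertex graph $P_1$ counts as a path) nor a cycle (isomorphic to the cycle graph $C_n$ for some $n\ge 3$). Let $L(\Gamma)$ be its line graph, i.e. the graph whose vertices are the edges of $\Gamma$, two distinct edges being adjacent when they share an endpoint. For a finite connected graph with $n$ vertices and $m$ edges, call the integer $m-n+1$ its circuit rank. Then the circuit rank of $L(\Gamma)$ is strictly greater than the circuit rank of $\Gamma$. -/

import Mathlib

namespace GainLine

/-- A graph is a path if it is isomorphic to the path graph on `n` vertices for some `n`. -/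
def IsPathGraph {V : Type*} (G : SimpleGraph V) : Prop :=
  ∃ n : ℕ, Nonempty (G ≃g SimpleGraph.pathGraph n)

/-- A graph is a cycle if it is isomorphic to the cycle graph on `n` vertices for some `n ≥ 3`. -/
def IsCycleGraph {V : Type*} (G : SimpleGraph V) : Prop :=
  ∃ n : ℕ, 3 ≤ n ∧ Nonempty (G ≃g SimpleGraph.cycleGraph n)

/-- The circuit rank `m - n + 1` of a finite connected graph with `n` vertices and `m` edges,
as an integer. -/
noncomputable def circuitRank {V : Type*} (G : SimpleGraph V) : ℤ :=
  (Nat.card G.edgeSet : ℤ) - (Nat.card V : ℤ) + 1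

end GainLine

/-! Let Γ have n vertices, m edges and degrees d(v). Pairs of edges meeting at v give Σ d(d-1) ≤
2|E(L(Γ))|, while Σ d = 2m. Since d(d-1) + 2 - 2d = (d-1)(d-2) ≥ 0, strictly once d ≥ 3, a vertex of
degree at least 3 yields 2m < |E(L(Γ))| + n. This is the claim, as L(Γ) has m vertices. Such a
vertex exists: otherwise a longest path spans Γ, which is then a path or a cycle. -/

namespace SimpleGraph

variable {V : Type*} {G : SimpleGraph V}

/-- A nonempty finite graph has a path whose length is maximal among all paths. -/
theorem exists_isPath_length_maximal [Finite V] [Nonempty V] (G : SimpleGraph V) :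
    ∃ (u v : V) (p : G.Walk u v), p.IsPath ∧
      ∀ (u' v' : V) (q : G.Walk u' v'), q.IsPath → q.length ≤ p.length := by
  classical
  have := Fintype.ofFinite V
  let P : ℕ → Prop := fun n => ∃ (u v : V) (p : G.Walk u v), p.IsPath ∧ p.length = n
  have hP0 : P 0 := ⟨Classical.arbitrary V, _, .nil, by simp, rfl⟩
  have hbound : ∀ n, P n → n ≤ Fintype.card V := by
    rintro n ⟨u, v, p, hp, rfl⟩
    exact hp.length_lt.le
  obtain ⟨u, v, p, hp, hlen⟩ := Nat.findGreatest_spec (P := P) (Nat.zero_le (Fintype.card V)) hP0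
  refine ⟨u, v, p, hp, fun u' v' q hq => ?_⟩
  rw [hlen]
  exact Nat.le_findGreatest (hbound _ ⟨u', v', q, hq, rfl⟩) ⟨u', v', q, hq, rfl⟩

/-- A connected finite graph in which every vertex has at most two neighbours is a path or a
cycle. -/
theorem Connected.isPathGraph_or_isCycleGraph [Finite V] (hG : G.Connected)
    (hdeg : ∀ v a b c, G.Adj v a → G.Adj v b → G.Adj v c → a = b ∨ b = c ∨ a = c) :
    GainLine.IsPathGraph G ∨ GainLine.IsCycleGraph G := by
  have := hG.nonempty
  obtain ⟨u, v, p, hp, hmax⟩ := G.exists_isPath_length_maximal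
  set n := p.length with hn
  have hinj : ∀ i j, i ≤ n → j ≤ n → p.getVert i = p.getVert j → i = j :=
    fun i j hi hj h => hp.getVert_injOn hi hj h
  have hsucc : ∀ i, i < n → G.Adj (p.getVert i) (p.getVert (i + 1)) :=
    fun i hi => p.adj_getVert_succ hi
  -- A neighbour off the path would extend it at an end, or be a third neighbour of an inner vertex.
  have hclosed : ∀ i, i ≤ n → ∀ w, G.Adj (p.getVert i) w → ∃ j ≤ n, p.getVert j = w := by
    intro i hi w hw
    by_contra! hne
    have hws : w ∉ p.support := by
      rw [Walk.mem_support_iff_exists_getVert]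
      rintro ⟨j, hj, hjn⟩
      exact hne j hjn hj
    rcases Nat.eq_zero_or_pos i with rfl | hi0
    · rw [Walk.getVert_zero] at hw
      have := hmax _ _ _ (hp.cons hws (h := hw.symm))
      simp at this
      omega
    rcases hi.eq_or_lt with rfl | hin
    · rw [hn, Walk.getVert_length] at hw
      have := hmax _ _ _ (hp.concat hws hw)
      simp at this
      omega
    · have h1 := hsucc (i - 1) (by omega)
      rw [Nat.sub_add_cancel hi0] at h1
      rcases hdeg _ _ _ _ h1.symm (hsucc i hin) hw with h | h | h
      · have := hinj _ _ (by omega) (by omega) h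
        omega
      · exact hne _ (by omega) h
      · exact hne _ (by omega) h
  have hsurj : ∀ w, ∃ j ≤ n, p.getVert j = w := by
    intro w
    obtain ⟨q⟩ := hG.preconnected w u
    induction q with
    | nil => exact ⟨0, Nat.zero_le _, p.getVert_zero⟩
    | cons h _ ih =>
      obtain ⟨j, hj, rfl⟩ := ih p hp hmax hn hinj hsucc hclosed
      exact hclosed j hj _ h.symm
  -- Any other chord has an inner endpoint, which would get a third neighbour.
  have hadj : ∀ i j, i < j → j ≤ n → G.Adj (p.getVert i) (p.getVert j) →
      j = i + 1 ∨ i = 0 ∧ j = n := by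
    intro i j hij hj h
    by_contra! hne
    rcases Nat.eq_zero_or_pos i with rfl | hi0
    · have hjn : j < n := lt_of_le_of_ne hj (hne.2 rfl)
      have h1 := hsucc (j - 1) (by omega)
      rw [Nat.sub_add_cancel hij] at h1
      rcases hdeg _ _ _ _ h1.symm (hsucc j hjn) h.symm with h | h | h <;>
      · have := hinj _ _ (by omega) (by omega) h
        omega
    · have h1 := hsucc (i - 1) (by omega)
      rw [Nat.sub_add_cancel hi0] at h1
      rcases hdeg _ _ _ _ h1.symm (hsucc i (by omega)) h with h | h | h <;>
      · have := hinj _ _ (by omega) (by omega) h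
        omega
  let e : Fin (n + 1) ≃ V := Equiv.ofBijective (fun i => p.getVert i) <| by
    refine ⟨fun i j h => Fin.ext (hinj _ _ (by omega) (by omega) h), fun w => ?_⟩
    obtain ⟨j, hj, rfl⟩ := hsurj w
    exact ⟨⟨j, by omega⟩, rfl⟩
  have he : ∀ i, e i = p.getVert i := fun i => rfl
  -- For `n = 1` the ends are adjacent, yet the graph is a path.
  by_cases hends : 2 ≤ n ∧ G.Adj (p.getVert 0) (p.getVert n)
  · refine .inr ⟨n + 1, by omega, ⟨RelIso.symm ⟨e, ?_⟩⟩⟩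
    have key : ∀ i j : Fin (n + 1), i < j →
        (G.Adj (e i) (e j) ↔ (cycleGraph (n + 1)).Adj i j) := by
      intro i j hij
      have hij' : (i : ℕ) < j := hij
      rw [he, he, cycleGraph_adj', Fin.sub_val_of_le hij.le, Fin.coe_sub_iff_lt.2 hij]
      constructor
      · intro h
        rcases hadj _ _ hij' (by omega) h with h | h <;> omega
      · intro h
        have : (j : ℕ) = i + 1 ∨ (i : ℕ) = 0 ∧ (j : ℕ) = n := by omega
        rcases this with h | ⟨h, h'⟩
        · rw [h]
          exact hsucc _ (by omega)
        · rw [h, h']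
          exact hends.2
    intro i j
    rcases lt_trichotomy i j with h | rfl | h
    · exact key i j h
    · simp
    · rw [G.adj_comm, key j i h, adj_comm]
  · refine .inl ⟨n + 1, ⟨RelIso.symm ⟨e, ?_⟩⟩⟩
    have key : ∀ i j : Fin (n + 1), i < j →
        (G.Adj (e i) (e j) ↔ (pathGraph (n + 1)).Adj i j) := by
      intro i j hij
      have hij' : (i : ℕ) < j := hij
      rw [he, he, pathGraph_adj]
      constructor
      · intro h
        rcases hadj _ _ hij' (by omega) h with h' | ⟨h0, hjn⟩
        · omega
        · rw [h0, hjn] at h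
          have : ¬ 2 ≤ n := fun h2 => hends ⟨h2, h⟩
          omega
      · intro h
        have : (j : ℕ) = i + 1 := by omega
        rw [this]
        exact hsucc _ (by omega)
    intro i j
    rcases lt_trichotomy i j with h | rfl | h
    · exact key i j h
    · simp
    · rw [G.adj_comm, key j i h, adj_comm]

/-- Two distinct edges at a vertex are adjacent in the line graph, so twice the number of edges
of the line graph is at least the number of ordered pairs of distinct neighbours of a vertex. -/
theorem sum_degree_mul_pred_le_two_mul_card_edgeSet_lineGraph [Fintype V] [DecidableRel G.Adj] :
    ∑ v, (G.degree v * G.degree v - G.degree v) ≤ 2 * Nat.card G.lineGraph.edgeSet := by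
  classical
  have hcard : 2 * Nat.card G.lineGraph.edgeSet = Fintype.card G.lineGraph.Dart := by
    rw [dart_card_eq_twice_card_edges, edgeFinset_card, Nat.card_eq_fintype_card]
  have hsum : ∑ v, (G.degree v * G.degree v - G.degree v) =
      Fintype.card (Σ v, (G.neighborFinset v).offDiag) := by
    simp only [Fintype.card_sigma, Fintype.card_coe, Finset.offDiag_card,
      card_neighborFinset_eq_degree]
  rw [hcard, hsum]
  have hmem : ∀ x : Σ v, (G.neighborFinset v).offDiag,
      G.Adj x.1 x.2.1.1 ∧ G.Adj x.1 x.2.1.2 ∧ x.2.1.1 ≠ x.2.1.2 := by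
    rintro ⟨v, ⟨a, b⟩, h⟩
    simpa using h
  refine Fintype.card_le_of_injective
    (fun x => (⟨(⟨s(x.1, x.2.1.1), (hmem x).1⟩, ⟨s(x.1, x.2.1.2), (hmem x).2.1⟩), ?_⟩ :
      G.lineGraph.Dart)) ?_
  · rw [lineGraph_adj_iff_exists]
    refine ⟨fun h => (hmem x).2.2 ?_, x.1, by simp, by simp⟩
    exact Sym2.congr_right.1 (congrArg Subtype.val h)
  · intro x y hxy
    have hx := hmem x
    have hy := hmem y
    obtain ⟨v, ⟨a, b⟩, h⟩ := x
    obtain ⟨w, ⟨c, d⟩, h'⟩ := y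
    simp only [Dart.mk.injEq, Prod.mk.injEq] at hxy
    -- Two distinct edges share at most one vertex, so the pair of edges determines `v`.
    obtain ⟨rfl, rfl, rfl⟩ : v = w ∧ a = c ∧ b = d := by
      simp only at hx hy
      grind
    rfl

end SimpleGraph

theorem corollary4p1 {V : Type*} [Finite V] (Γ : SimpleGraph V) (hconn : Γ.Connected)
    (hpath : ¬ GainLine.IsPathGraph Γ) (hcycle : ¬ GainLine.IsCycleGraph Γ) :
    GainLine.circuitRank Γ < GainLine.circuitRank Γ.lineGraph := by
  classical
  have := Fintype.ofFinite V
  obtain ⟨v, hv⟩ : ∃ v, 2 < Γ.degree v := by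
    by_contra! hdeg
    refine (hconn.isPathGraph_or_isCycleGraph fun v a b c ha hb hc => ?_).elim hpath hcycle
    by_contra! hne
    refine (hdeg v).not_gt (Finset.two_lt_card.2 ⟨a, ?_, b, ?_, c, ?_, hne.1, hne.2.2, hne.2.1⟩) <;>
      simpa
  have hline := Γ.sum_degree_mul_pred_le_two_mul_card_edgeSet_lineGraph
  have hhand : ∑ v, Γ.degree v = 2 * Nat.card Γ.edgeSet := by
    rw [Γ.sum_degrees_eq_twice_card_edges, Nat.card_eq_fintype_card, ← Γ.edgeFinset_card]
  have hlocal : ∑ v, (2 * Γ.degree v) < ∑ v, ((Γ.degree v * Γ.degree v - Γ.degree v) + 2) := by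
    refine Finset.sum_lt_sum (fun w _ => ?_) ⟨v, Finset.mem_univ v, ?_⟩
    · rcases Nat.lt_or_ge (Γ.degree w) 3 with h | h
      · interval_cases Γ.degree w <;> simp
      · have := Nat.mul_le_mul_right (Γ.degree w) h
        omega
    · have := Nat.mul_le_mul_right (Γ.degree v) hv
      omega
  rw [← Finset.mul_sum, hhand, Finset.sum_add_distrib, Finset.sum_const, Finset.card_univ,
    smul_eq_mul, ← Nat.card_eq_fintype_card] at hlocal
  unfold GainLine.circuitRank
  omega
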